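/- Consider $2$-Facility Location on the line with $n\ge 5$ agents. A deterministic mechanism $F$ maps every location profile $x=(x_1,\dots,x_n)\in\mathbb{R}^n$ to a pair of facility locations $F(x)=(F_1(x),F_2(x))\in\mathbb{R}^2$ with $F_1(x)\le F_2(x)$. For $a\in\mathbb{R}$ and $y=(y_1,y_2)\in\mathbb{R}^2$ let $\mathrm{cost}(a,y)=\min\{|a-y_1|,|a-y_2|\}$. The mechanism $F$ is strategyproof if $\mathrm{cost}(x_i,F(x))\le \mathrm{cost}(x_i,F(x_{-i},z))$ for every profile $x$, every agent $i$ and every $z\in\mathbb{R}$, where $(x_{-i},z)$ is $x$ with $x_i$ replaced by $z$. It has an approximation ratio of $\rho\ge 1$ (for the total connection cost) if $$\sum_{i=1}^n \mathrm{cost}(x_i,F(x))\;\le\;\rho\cdot\min_{y\in\mathbb{R}^2}\sum_{i=1}^n \mathrm{cost}(x_i,y)\qquad\text{for every } x\in\mathbb{R}^n .$$ Then every deterministic strategyproof mechanism for $2$-Facility Location on the line with $n\ge 5$ agents has an approximation ratio of at least $n-2$: if it has an approximation ratio of $\rho$, then $\rho\ge n-2$. Moreover, the Two-Extremes mechanism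 $x\mapsto(\min_i x_i,\max_i x_i)$ is strategyproof and has an approximation ratio of $n-2$. Hence $n-2$ is the smallest $\rho$ for which some deterministic strategyproof mechanism for $2$-Facility Location with $n$ agents has an approximation ratio of $\rho$. -/

import Mathlib

namespace FacilityLocation

/-- A deterministic mechanism for `K`-Facility Location on the line with `n` agents: it maps every
location profile to a tuple of facility locations, listed in nondecreasing order. -/
structure Mechanism (n K : ℕ) where
  /-- The facility locations chosen for a location profile. -/
  outcome : (Fin n → ℝ) → Fin K → ℝ
  /-- Facilities are listed from left to right. -/
  sorted : ∀ x, Monotone (outcome x)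

/-- The cost of an agent at `a` for the facilities `y`: the distance to the nearest facility. -/
noncomputable def agentCost {K : ℕ} [NeZero K] (a : ℝ) (y : Fin K → ℝ) : ℝ :=
  Finset.univ.inf' Finset.univ_nonempty (fun l => |a - y l|)

/-- The total connection cost of the profile `x` for the facilities `y`. -/
noncomputable def socialCost {n K : ℕ} [NeZero K] (x : Fin n → ℝ) (y : Fin K → ℝ) : ℝ :=
  ∑ i, agentCost (x i) y

/-- The optimal total connection cost of the profile `x` with `K` facilities
(the infimum of a nonnegative function, over all tuples of facility locations). -/
noncomputable def optCost {n : ℕ} (K : ℕ) [NeZero K] (x : Fin n → ℝ) : ℝ :=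
  ⨅ y : Fin K → ℝ, socialCost x y

namespace Mechanism

/-- No agent can decrease her cost by misreporting her location. -/
def Strategyproof {n K : ℕ} [NeZero K] (F : Mechanism n K) : Prop :=
  ∀ (x : Fin n → ℝ) (i : Fin n) (y : ℝ),
    agentCost (x i) (F.outcome x) ≤ agentCost (x i) (F.outcome (Function.update x i y))

/-- `F` has an approximation ratio of `ρ ≥ 1` for the total connection cost. -/
def HasApproxRatio {n K : ℕ} [NeZero K] (F : Mechanism n K) (ρ : ℝ) : Prop :=
  1 ≤ ρ ∧ ∀ x : Fin n → ℝ, socialCost x (F.outcome x) ≤ ρ * optCost K x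

end Mechanism

/-- The Two-Extremes mechanism: the facilities are placed at the leftmost and at the rightmost
reported location. -/
noncomputable def twoExtremes (n : ℕ) : Mechanism n 2 where
  outcome x := ![⨅ i, x i, ⨆ i, x i]
  sorted x := by
    have h : (⨅ i, x i) ≤ ⨆ i, x i := by
      rcases isEmpty_or_nonempty (Fin n) with h | h
      · simp [Real.iInf_of_isEmpty, Real.iSup_of_isEmpty]
      · obtain ⟨i⟩ := h
        exact (ciInf_le (Set.finite_range x).bddBelow i).trans
          (le_ciSup (Set.finite_range x).bddAbove i)
    intro a b hab
    fin_cases a <;> fin_cases b <;> simp_all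

end FacilityLocation

namespace FacilityLocation

/-! Only two consequences of the hypotheses are needed: coalitions at a common location cannot gain,
and every agent's cost is bounded by a constant times the covering radius of the profile by two
points (`Nice`). Hence a facility survives when agents move onto it (`Hit.move`).

Merge the agents into three groups. If the middle group is served in one profile, it is served in
every profile left of a given point once the right group is far enough away
(`eventually_hit_right`). Two groups cannot both have this power when they exchange the roles of
left and middle: in a profile with facilities at both of them, their distance could always be
shortened, although the covering bound keeps it away from zero (`avoidsMiddle_or_swap`).

The rest is combinatorics. Call a set of agents decisive if it is never avoided in the middle,
whichever agents are on its left. Disjoint decisive sets must exhaust the agents. If all sets of n -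
2 agents were decisive, a decisive set of least size would yield two disjoint decisive pairs,
impossible for n ≥ 5 (`exists_avoids`). So some n - 2 agents at 1, with the other two at 0 and 3,
each pay at least 1, while the optimum is at most 1. -/

/-- A one-dimensional choice `h` that is strategyproof for a single agent, never to her left, and
unanimous at the left end of an interval is exact on the whole interval. -/
theorem eq_self_of_le_of_strategyproof {u v : ℝ} {h : ℝ → ℝ}
    (hr : ∀ x ∈ Set.Icc u v, x ≤ h x ∧ h x ≤ v)
    (hsp : ∀ x ∈ Set.Icc u v, ∀ y ∈ Set.Icc u v, |x - h x| ≤ |x - h y|)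
    (hu : h u = u) : ∀ x ∈ Set.Icc u v, h x = x := by
  intro x hx
  by_contra hne
  have hlt : x < h x := lt_of_le_of_ne (hr x hx).1 (Ne.symm hne)
  set S : Set ℝ := {y | y ∈ Set.Icc u x ∧ h y = y} with hS
  have huS : u ∈ S := ⟨⟨le_rfl, hx.1⟩, hu⟩
  have hbdd : BddAbove S := ⟨x, fun y hy => hy.1.2⟩
  set l := sSup S with hl
  have hlx : l ≤ x := csSup_le ⟨u, huS⟩ fun y hy => hy.1.2
  have hul : u ≤ l := le_csSup hbdd huS
  -- points of `S` keep away from `x`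
  have hfar : ∀ y ∈ S, h x - x ≤ x - y := by
    intro y hy
    have := hsp x hx y ⟨hy.1.1, hy.1.2.trans hx.2⟩
    rw [hy.2, abs_sub_comm, abs_of_pos (by linarith), abs_of_nonneg (by linarith [hy.1.2])] at this
    exact this
  have hlx' : l ≤ x - (h x - x) := csSup_le ⟨u, huS⟩ fun y hy => by linarith [hfar y hy]
  -- Fixed points stop at `l`, strictly below `x`. The report `l + e` is answered less than `2 * e`
  -- to its right, because a fixed point lies within `e` below `l`. This answer is still below `x`,
  -- and it is itself a fixed point, since reporting `l + e` from there costs nothing.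
  set e := (x - l) / 8 with he
  have hepos : 0 < e := by rw [he]; linarith
  obtain ⟨y, hyS, hy⟩ := exists_lt_of_lt_csSup ⟨u, huS⟩ (show l - e < sSup S by linarith)
  have hz : l + e ∈ Set.Icc u v := ⟨by linarith, by linarith [hx.2]⟩
  have hyI : y ∈ Set.Icc u v := ⟨hyS.1.1, hyS.1.2.trans hx.2⟩
  have hyl : y ≤ l := le_csSup hbdd hyS
  have h1 := hsp (l + e) hz y hyI
  have h2 := hr (l + e) hz
  rw [hyS.2, abs_sub_comm, abs_of_nonneg (by linarith), abs_of_nonneg (by linarith)] at h1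
  have h3 : h (l + e) ∈ S := by
    refine ⟨⟨by linarith, by linarith⟩, ?_⟩
    have hzz : h (l + e) ∈ Set.Icc u v := ⟨by linarith, by linarith⟩
    have := hsp _ hzz (l + e) hz
    rw [sub_self, abs_zero] at this
    have := abs_nonpos_iff.1 this
    linarith
  have := le_csSup hbdd h3
  linarith

/-- The mirror image of `eq_self_of_le_of_strategyproof`. -/
theorem eq_self_of_ge_of_strategyproof {u v : ℝ} {h : ℝ → ℝ}
    (hr : ∀ x ∈ Set.Icc u v, u ≤ h x ∧ h x ≤ x)
    (hsp : ∀ x ∈ Set.Icc u v, ∀ y ∈ Set.Icc u v, |x - h x| ≤ |x - h y|)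
    (hv : h v = v) : ∀ x ∈ Set.Icc u v, h x = x := by
  have key := eq_self_of_le_of_strategyproof (u := -v) (v := -u) (h := fun x => -h (-x))
    (fun x hx => by
      have := hr (-x) ⟨by linarith [hx.2], by linarith [hx.1]⟩
      constructor <;> linarith)
    (fun x hx y hy => by
      have := hsp (-x) ⟨by linarith [hx.2], by linarith [hx.1]⟩ (-y)
        ⟨by linarith [hy.2], by linarith [hy.1]⟩
      rw [← abs_neg (x - -h (-x)), ← abs_neg (x - -h (-y))]
      convert this using 2 <;> ring)
    (by simp [hv])
  intro x hx
  have := key (-x) ⟨by linarith [hx.2], by linarith [hx.1]⟩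
  simp only [neg_neg] at this
  linarith

/-! ### Mechanisms for abstract groups of agents -/

/-- A mechanism placing two facilities `f x ≤ g x`, strategyproof for coalitions of agents at the
same location, and in which the cost of every agent is at most `K` times the covering radius of the
profile by two points. -/
structure Nice (ι : Type*) (K : ℝ) where
  /-- The left facility. -/
  f : (ι → ℝ) → ℝ
  /-- The right facility. -/
  g : (ι → ℝ) → ℝ
  le : ∀ x, f x ≤ g x
  sp : ∀ x y p, (∀ i, x i = p ∨ x i = y i) → min |p - f x| |p - g x| ≤ min |p - f y| |p - g y|
  one_le : 1 ≤ K
  ratio : ∀ x y₁ y₂ δ, (∀ j, |x j - y₁| ≤ δ ∨ |x j - y₂| ≤ δ) →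
    ∀ i, min |x i - f x| |x i - g x| ≤ K * δ

namespace Nice

variable {ι κ : Type*} {K : ℝ}

/-- The distance from `p` to the nearest facility. -/
noncomputable def cost (N : Nice ι K) (p : ℝ) (x : ι → ℝ) : ℝ := min |p - N.f x| |p - N.g x|

/-- A facility is placed at `p`. -/
def Hit (N : Nice ι K) (p : ℝ) (x : ι → ℝ) : Prop := p = N.f x ∨ p = N.g x

/-- The mechanism for the groups of agents given by a surjective map. -/
def pull (N : Nice ι K) (σ : ι → κ) (hσ : Function.Surjective σ) : Nice κ K where
  f v := N.f (v ∘ σ)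
  g v := N.g (v ∘ σ)
  le v := N.le _
  sp x y p h := N.sp _ _ p fun i => h (σ i)
  one_le := N.one_le
  ratio x y₁ y₂ δ h k := by
    obtain ⟨i, rfl⟩ := hσ k
    exact N.ratio (x ∘ σ) y₁ y₂ δ (fun j => h (σ j)) i

/-- The mechanism conjugated by the reflection of the line. -/
def reflect (N : Nice ι K) : Nice ι K where
  f x := -N.g (-x)
  g x := -N.f (-x)
  le x := neg_le_neg (N.le _)
  sp x y p h := by
    have := N.sp (-x) (-y) (-p) fun i => by
      simpa only [Pi.neg_apply, neg_inj] using h i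
    have e : ∀ t : ℝ, |p - -t| = |-p - t| := fun t => by
      rw [← abs_neg]; congr 1; ring
    simp only [e]
    rwa [min_comm, min_comm |-p - N.g (-y)|]
  one_le := N.one_le
  ratio x y₁ y₂ δ h i := by
    have := N.ratio (-x) (-y₁) (-y₂) δ (fun j => by
      have e : ∀ t : ℝ, |(-x) j - -t| = |x j - t| := fun t => by
        rw [← abs_neg, Pi.neg_apply]; congr 1; ring
      simpa only [e] using h j) i
    have e : ∀ t : ℝ, |x i - -t| = |(-x) i - t| := fun t => by
      rw [← abs_neg, Pi.neg_apply]; congr 1; ring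
    simp only [e]
    rwa [min_comm]

theorem K_pos (N : Nice ι K) : 0 < K := lt_of_lt_of_le one_pos N.one_le

theorem hit_iff_cost (N : Nice ι K) {p : ℝ} {x : ι → ℝ} : N.Hit p x ↔ N.cost p x ≤ 0 := by
  simp [cost, Hit, sub_eq_zero]

theorem cost_le_of_hit (N : Nice ι K) {p q : ℝ} {x : ι → ℝ} (h : N.Hit q x) :
    N.cost p x ≤ |p - q| := by
  rcases h with rfl | rfl
  · exact min_le_left _ _
  · exact min_le_right _ _

theorem exists_hit (N : Nice ι K) (p : ℝ) (x : ι → ℝ) : ∃ q, N.Hit q x ∧ N.cost p x = |p - q| := by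
  rcases min_choice |p - N.f x| |p - N.g x| with h | h
  · exact ⟨_, Or.inl rfl, h⟩
  · exact ⟨_, Or.inr rfl, h⟩

theorem cost_le_cost (N : Nice ι K) {x y : ι → ℝ} {p : ℝ} (h : ∀ i, x i = p ∨ x i = y i) :
    N.cost p x ≤ N.cost p y := N.sp x y p h

theorem cost_le_of_option (N : Nice ι K) {x y : ι → ℝ} {p q : ℝ} (h : ∀ i, x i = p ∨ x i = y i)
    (hq : N.Hit q y) : N.cost p x ≤ |p - q| := (N.sp x y p h).trans (N.cost_le_of_hit hq)

/-- A coalition standing at `p` could report its old locations and pay nothing, so it must also pay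
nothing when truthful. -/
theorem Hit.move {N : Nice ι K} {x y : ι → ℝ} {p : ℝ} (hp : N.Hit p y)
    (h : ∀ i, x i = p ∨ x i = y i) : N.Hit p x :=
  N.hit_iff_cost.2 ((N.cost_le_cost h).trans (N.hit_iff_cost.1 hp))

theorem cost_le_ratio (N : Nice ι K) {x : ι → ℝ} (y₁ y₂ δ : ℝ)
    (h : ∀ j, |x j - y₁| ≤ δ ∨ |x j - y₂| ≤ δ) (i : ι) : N.cost (x i) x ≤ K * δ :=
  N.ratio x y₁ y₂ δ h i

/-! ### Three groups of agents -/

section three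

variable (M : Nice (Fin 3) K)

theorem cost0 {a a' x d : ℝ} : M.cost a ![a, x, d] ≤ M.cost a ![a', x, d] :=
  M.cost_le_cost (by simp [Fin.forall_fin_succ])

theorem cost1 {a x x' d : ℝ} : M.cost x ![a, x, d] ≤ M.cost x ![a, x', d] :=
  M.cost_le_cost (by simp [Fin.forall_fin_succ])

theorem cost2 {a x d d' : ℝ} : M.cost d ![a, x, d] ≤ M.cost d ![a, x, d'] :=
  M.cost_le_cost (by simp [Fin.forall_fin_succ])

theorem hit0 {a q x d : ℝ} (h : M.Hit q ![a, x, d]) : M.Hit q ![q, x, d] :=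
  h.move (by simp [Fin.forall_fin_succ])

theorem hit1 {a q x d : ℝ} (h : M.Hit q ![a, x, d]) : M.Hit q ![a, q, d] :=
  h.move (by simp [Fin.forall_fin_succ])

theorem hit2 {a q x d : ℝ} (h : M.Hit q ![a, x, d]) : M.Hit q ![a, x, q] :=
  h.move (by simp [Fin.forall_fin_succ])

theorem ratio3 {a x d : ℝ} (y₁ y₂ δ : ℝ) (ha : |a - y₁| ≤ δ ∨ |a - y₂| ≤ δ)
    (hx : |x - y₁| ≤ δ ∨ |x - y₂| ≤ δ) (hd : |d - y₁| ≤ δ ∨ |d - y₂| ≤ δ) :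
    M.cost a ![a, x, d] ≤ K * δ ∧ M.cost x ![a, x, d] ≤ K * δ ∧ M.cost d ![a, x, d] ≤ K * δ := by
  have h : ∀ j, |(![a, x, d] : Fin 3 → ℝ) j - y₁| ≤ δ ∨ |(![a, x, d] : Fin 3 → ℝ) j - y₂| ≤ δ := by
    simp only [Fin.forall_fin_succ]
    exact ⟨ha, hx, hd, fun i => i.elim0⟩
  exact ⟨M.cost_le_ratio y₁ y₂ δ h 0, M.cost_le_ratio y₁ y₂ δ h 1, M.cost_le_ratio y₁ y₂ δ h 2⟩

theorem hit_left_pair (a d : ℝ) : M.Hit a ![a, a, d] ∧ M.Hit d ![a, a, d] := by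
  have := M.ratio3 (a := a) (x := a) (d := d) a d 0 (by simp) (by simp) (by simp)
  rw [mul_zero] at this
  exact ⟨M.hit_iff_cost.2 this.1, M.hit_iff_cost.2 this.2.2⟩

theorem hit_right_pair (a d : ℝ) : M.Hit a ![a, d, d] ∧ M.Hit d ![a, d, d] := by
  have := M.ratio3 (a := a) (x := d) (d := d) a d 0 (by simp) (by simp) (by simp)
  rw [mul_zero] at this
  exact ⟨M.hit_iff_cost.2 this.1, M.hit_iff_cost.2 this.2.2⟩

/-- The groups are at the positions `a < x < d` and the middle one gets no facility, whatever these
positions are. -/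
def AvoidsMiddle : Prop := ∀ a x d : ℝ, a < x → x < d → ¬ M.Hit x ![a, x, d]

/-! ### Propagating service of the middle group -/

/-- The two right groups are so close that the covering bound sends one facility near `a` and the
other near the pair. Each of the two groups can join the other, which confines the right facility to
the interval between them. -/
theorem near_bounds {a x₀ x d : ℝ} (ha : a < x₀) (hx : x₀ ≤ x) (hxd : x ≤ d)
    (hd : d ≤ x₀ + (x₀ - a) / (4 * K)) :
    M.f ![a, x, d] ≤ a + (x₀ - a) / 4 ∧ x ≤ M.g ![a, x, d] ∧ M.g ![a, x, d] ≤ d ∧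
      d - x ≤ (x₀ - a) / 4 := by
  have hK := M.K_pos
  have hdx : K * (d - x) ≤ (x₀ - a) / 4 := by
    have h1 : d - x ≤ (x₀ - a) / (4 * K) := by linarith
    calc K * (d - x) ≤ K * ((x₀ - a) / (4 * K)) := by gcongr
      _ = (x₀ - a) / 4 := by field_simp
  have hdx' : d - x ≤ (x₀ - a) / 4 := by nlinarith [M.one_le]
  obtain ⟨h1, h2, -⟩ := M.ratio3 (a := a) (x := x) (d := d) a x (d - x) (by simp [hxd])
    (by simp [hxd]) (Or.inr (by rw [abs_of_nonneg (by linarith)]))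
  have h3 : M.cost x ![a, x, d] ≤ |x - d| :=
    M.cost1.trans (M.cost_le_of_hit (M.hit_right_pair a d).2)
  have h4 : M.cost d ![a, x, d] ≤ |d - x| :=
    M.cost2.trans (M.cost_le_of_hit (M.hit_right_pair a x).2)
  rw [abs_sub_comm, abs_of_nonneg (by linarith)] at h3
  rw [abs_of_nonneg (by linarith)] at h4
  have hle := M.le ![a, x, d]
  simp only [cost] at h1 h2 h3 h4
  generalize M.f ![a, x, d] = p at *
  generalize M.g ![a, x, d] = q at *
  have hp : |a - p| ≤ (x₀ - a) / 4 := by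
    rcases min_le_iff.1 (h1.trans hdx) with h | h
    · exact h
    · exfalso
      have := abs_le.1 h
      rcases min_le_iff.1 (h2.trans hdx) with h' | h' <;> have := abs_le.1 h' <;> linarith
  have hp' := abs_le.1 hp
  refine ⟨by linarith, ?_, ?_, hdx'⟩
  · rcases min_le_iff.1 h4 with h | h <;> have := abs_le.1 h <;> linarith
  · rcases min_le_iff.1 h3 with h | h <;> have := abs_le.1 h <;> linarith

/-- In this range the right facility is a one-dimensional strategyproof choice in either report.
Were it to leave `x₀` for some `d`, it would follow reports of the right group just above `x₀`, and
one of them would attract that group in the profile at `d₀`. So it stays at `x₀`, and this anchors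
the choice when the middle group moves. -/
theorem near_g_eq {a x₀ d₀ x d : ℝ} (ha : a < x₀) (h₀ : x₀ < d₀) (hg : M.g ![a, x₀, d₀] = x₀)
    (hx : x₀ ≤ x) (hxd : x ≤ d) (hd : d ≤ x₀ + (x₀ - a) / (4 * K)) : M.g ![a, x, d] = x := by
  have nb := fun {x d : ℝ} => M.near_bounds (x := x) (d := d) ha
  have base : M.g ![a, x₀, d] = x₀ := by
    obtain ⟨-, hy1, hy2, -⟩ := nb le_rfl (hx.trans hxd) hd
    set y := M.g ![a, x₀, d] with hy
    by_contra hne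
    have hlt : x₀ < y := lt_of_le_of_ne hy1 (Ne.symm hne)
    have hyy : M.g ![a, x₀, y] = y := by
      have h := M.hit2 (Or.inr hy : M.Hit y ![a, x₀, d])
      have := nb le_rfl hy1 (hy2.trans hd)
      rcases h with h | h <;> linarith
    have key := eq_self_of_ge_of_strategyproof (u := x₀) (v := y) (h := fun t => M.g ![a, x₀, t])
      (fun t ht => by
        have := nb le_rfl ht.1 ((ht.2.trans hy2).trans hd)
        exact ⟨this.2.1, this.2.2.1⟩)
      (fun t ht s _ => by
        have h1 := nb le_rfl ht.1 ((ht.2.trans hy2).trans hd)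
        have h2 : M.cost t ![a, x₀, t] ≤ M.cost t ![a, x₀, s] := M.cost2
        have h3 := h2.trans (min_le_right _ _)
        rcases min_le_iff.1 h3 with h | h
        · refine le_trans ?_ h
          rw [abs_of_nonneg (by linarith [ht.1]), abs_of_nonneg (by linarith [ht.1])]
          linarith
        · exact h) hyy
    set t := min d₀ y with ht
    have htx : x₀ < t := lt_min h₀ hlt
    have ht' : M.g ![a, x₀, t] = t := key t ⟨htx.le, min_le_right _ _⟩
    have h1 : M.cost d₀ ![a, x₀, d₀] ≤ |d₀ - t| :=
      M.cost2.trans (M.cost_le_of_hit (Or.inr ht'.symm))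
    have htd : t ≤ d₀ := min_le_left _ _
    have hle := M.le ![a, x₀, d₀]
    rw [abs_of_nonneg (by linarith)] at h1
    rcases min_le_iff.1 h1 with h | h <;> have := abs_le.1 h <;> linarith
  refine eq_self_of_le_of_strategyproof (u := x₀) (v := d) (h := fun t => M.g ![a, t, d])
    (fun t ht => ?_) (fun t ht s _ => ?_) base x ⟨hx, hxd⟩
  · have := nb ht.1 ht.2 hd
    exact ⟨this.2.1, this.2.2.1⟩
  · have h1 := nb ht.1 ht.2 hd
    have h2 : M.cost t ![a, t, d] ≤ M.cost t ![a, s, d] := M.cost1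
    have h3 := h2.trans (min_le_right _ _)
    rcases min_le_iff.1 h3 with h | h
    · refine le_trans ?_ h
      rw [abs_sub_comm, abs_of_nonneg (by linarith [ht.1]), abs_of_nonneg (by linarith [ht.1])]
      linarith [ht.1, ht.2]
    · exact h

/-- Each use of `near_g_eq` covers a window of length at least `2 * e`, so it provides a new
starting point `e` further right; the windows do not shrink as the distance to `a` grows. -/
theorem near_g_eq_of_le {a x₀ d₀ : ℝ} (ha : a < x₀) (h₀ : x₀ < d₀) (hg : M.g ![a, x₀, d₀] = x₀) :
    ∀ x d, x₀ ≤ x → x < d → d ≤ x + (x₀ - a) / (8 * K) → M.g ![a, x, d] = x := by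
  have hK := M.K_pos
  set e := (x₀ - a) / (8 * K) with he
  have hepos : 0 < e := div_pos (by linarith) (by linarith)
  have h2e : (x₀ - a) / (4 * K) = 2 * e := by rw [he]; field_simp; ring
  have step : ∀ k : ℕ, ∀ x d, x₀ ≤ x → x ≤ x₀ + k * e → x < d → d ≤ x + e →
      M.g ![a, x, d] = x := by
    intro k
    induction k with
    | zero =>
      intro x d hx hx' hxd hd
      refine M.near_g_eq ha h₀ hg hx hxd.le ?_
      simp only [Nat.cast_zero, zero_mul, add_zero] at hx'
      linarith
    | succ k ih =>
      intro x d hx hx' hxd hd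
      push_cast at hx'
      set z := max x₀ (x - e) with hz
      have hz1 : x₀ ≤ z := le_max_left _ _
      have hz2 : x - e ≤ z := le_max_right _ _
      have hzx : z ≤ x := max_le hx (by linarith)
      have hzg := ih z (z + e) hz1 (max_le (le_add_of_nonneg_right (by positivity)) (by linarith)) (by linarith) le_rfl
      refine M.near_g_eq (ha.trans_le hz1) (by linarith) hzg hzx hxd.le ?_
      have : (x₀ - a) / (4 * K) ≤ (z - a) / (4 * K) := by gcongr
      linarith
  intro x d hx hxd hd
  obtain ⟨k, hk⟩ := exists_nat_ge ((x - x₀) / e)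
  rw [div_le_iff₀ hepos] at hk
  exact step k x d hx (by linarith) hxd hd

/-- If the right facility serves the middle group exactly once, then the middle group always gets a
facility further to the right. -/
theorem hit_of_g_eq {a x₀ d₀ : ℝ} (ha : a < x₀) (h₀ : x₀ < d₀) (hg : M.g ![a, x₀, d₀] = x₀) :
    ∀ x d, x₀ ≤ x → x < d → M.Hit x ![a, x, d] := by
  intro x d hx hxd
  have near := M.near_g_eq_of_le ha h₀ hg
  have hK := M.K_pos
  set e := (x₀ - a) / (8 * K) with he
  have hepos : 0 < e := div_pos (by linarith) (by linarith)
  by_contra hnot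
  have hc : 0 < M.cost x ![a, x, d] := not_le.1 fun h => hnot (M.hit_iff_cost.2 h)
  set c := M.cost x ![a, x, d] with hcdef
  set S : Set ℝ := {y | x ≤ y ∧ M.Hit y ![a, y, d]} with hS
  have hdS : d ∈ S := ⟨hxd.le, (M.hit_right_pair a d).2⟩
  have hfar : ∀ y ∈ S, x + c ≤ y := by
    intro y hy
    have : c ≤ |x - y| := M.cost1.trans (M.cost_le_of_hit hy.2)
    rw [abs_sub_comm, abs_of_nonneg (by linarith [hy.1])] at this
    linarith
  have hbdd : BddBelow S := ⟨x, fun y hy => hy.1⟩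
  set r := sInf S with hr
  have hxr : x + c ≤ r := le_csInf ⟨d, hdS⟩ hfar
  -- Just below `r` the middle group is served at some `q ≥ r`, by the right facility. Pulling the
  -- right group to `q` keeps that facility, but now both groups are within `e`, where `near` puts
  -- the right facility at `r - η < q`.
  set η := min (c / 4) (e / 4) with hη
  have hη0 : 0 < η := lt_min (by linarith) (by linarith)
  have hηc : η ≤ c / 4 := min_le_left _ _
  have hηe : η ≤ e / 4 := min_le_right _ _
  obtain ⟨y, hyS, hy⟩ := exists_lt_of_csInf_lt ⟨d, hdS⟩ (show sInf S < r + η by linarith)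
  have hry : r ≤ y := csInf_le hbdd hyS
  obtain ⟨q, hq, hqc⟩ := M.exists_hit (r - η) ![a, r - η, d]
  have h1 : |r - η - q| ≤ |r - η - y| := hqc ▸ M.cost1.trans (M.cost_le_of_hit hyS.2)
  rw [abs_sub_comm _ y, abs_of_nonneg (a := y - (r - η)) (by linarith)] at h1
  have h1' := abs_le.1 h1
  have hqS : q ∈ S := ⟨by linarith, M.hit1 hq⟩
  have hrq : r ≤ q := csInf_le hbdd hqS
  have hqg : q = M.g ![a, r - η, d] := by
    rcases hq with hq | hq
    · exfalso
      have hle := M.le ![a, r - η, d]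
      have h2 : M.cost a ![a, r - η, d] ≤ |a - (r - η)| :=
        M.cost0.trans (M.cost_le_of_hit (M.hit_left_pair (r - η) d).1)
      rw [abs_sub_comm, abs_of_nonneg (by linarith)] at h2
      rcases min_le_iff.1 h2 with h | h <;> have := abs_le.1 h <;> linarith
    · exact hq
  have hq' := M.hit2 (Or.inr hqg : M.Hit q ![a, r - η, d])
  have hg' := near (r - η) q (by linarith) (by linarith) (by linarith)
  have hle := M.le ![a, r - η, q]
  rcases hq' with h | h <;> linarith

/-- The mirror image of a mechanism for three groups. -/
def mirror : Nice (Fin 3) K := M.reflect.pull Fin.rev Fin.rev_surjective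

theorem neg_comp_rev (a x d : ℝ) :
    -((![a, x, d] : Fin 3 → ℝ) ∘ Fin.rev) = ![-d, -x, -a] := by
  ext i
  fin_cases i <;> rfl

theorem mirror_f (a x d : ℝ) : M.mirror.f ![a, x, d] = -M.g ![-d, -x, -a] := by
  rw [← neg_comp_rev]; rfl

theorem mirror_g (a x d : ℝ) : M.mirror.g ![a, x, d] = -M.f ![-d, -x, -a] := by
  rw [← neg_comp_rev]; rfl

theorem mirror_hit (q a x d : ℝ) : M.mirror.Hit q ![a, x, d] ↔ M.Hit (-q) ![-d, -x, -a] := by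
  simp only [Hit, mirror_f, mirror_g]
  rw [or_comm, eq_neg_iff_add_eq_zero, eq_neg_iff_add_eq_zero, neg_eq_iff_add_eq_zero,
    neg_eq_iff_add_eq_zero]

theorem mirror_avoidsMiddle : M.mirror.AvoidsMiddle ↔ M.AvoidsMiddle := by
  constructor
  · intro h a x d hax hxd hhit
    refine h (-d) (-x) (-a) (by linarith) (by linarith) ((M.mirror_hit _ _ _ _).2 ?_)
    simpa using hhit
  · intro h a x d hax hxd hhit
    exact h (-d) (-x) (-a) (by linarith) (by linarith) ((M.mirror_hit _ _ _ _).1 hhit)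

theorem hit_of_f_eq {a₀ x₀ d : ℝ} (ha : a₀ < x₀) (h₀ : x₀ < d) (hf : M.f ![a₀, x₀, d] = x₀) :
    ∀ a x, x ≤ x₀ → a < x → M.Hit x ![a, x, d] := by
  intro a x hx hax
  have := M.mirror.hit_of_g_eq (a := -d) (x₀ := -x₀) (d₀ := -a₀) (by linarith) (by linarith)
    (by rw [mirror_g]; simp [hf]) (-x) (-a) (by linarith) (by linarith)
  simpa [mirror_hit] using this

/-- A distant right group requires a facility near it, so the one serving the middle group must be
the left one. -/
theorem eventually_f_eq {a x : ℝ} (ha : a < x) (h : ∀ d, x < d → M.Hit x ![a, x, d]) :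
    ∃ D, x < D ∧ ∀ d, D ≤ d → M.f ![a, x, d] = x := by
  have hK := M.K_pos
  refine ⟨x + K * (x - a) + 1, by nlinarith, fun d hd => ?_⟩
  have hK' : 0 < K * (x - a) := mul_pos hK (by linarith)
  have hxd : x < d := by linarith
  obtain ⟨-, -, h3⟩ := M.ratio3 (a := a) (x := x) (d := d) x d (x - a)
    (Or.inl (by rw [abs_sub_comm, abs_of_pos (by linarith)])) (Or.inl (by simp [ha.le]))
    (Or.inr (by simp [ha.le]))
  rcases h d hxd with h | h
  · exact h.symm
  · exfalso
    have hle := M.le ![a, x, d]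
    rcases min_le_iff.1 h3 with h' | h' <;> have := abs_le.1 h' <;> linarith

theorem eventually_g_eq {x d : ℝ} (hd : x < d) (h : ∀ a, a < x → M.Hit x ![a, x, d]) :
    ∃ A, A < x ∧ ∀ a, a ≤ A → M.g ![a, x, d] = x := by
  obtain ⟨D, hD, hD'⟩ := M.mirror.eventually_f_eq (a := -d) (x := -x) (by linarith)
    (fun e he => by
      rw [mirror_hit]
      simpa using h (-e) (by linarith))
  refine ⟨-D, by linarith, fun a ha => ?_⟩
  have := hD' (-a) (by linarith)
  rw [mirror_f] at this
  simpa using this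

/-- If the middle group ever gets a facility, then it does so on every left half-line, as soon as
the right group is far away. -/
theorem eventually_hit_right (h : ¬ M.AvoidsMiddle) (X : ℝ) :
    ∃ D, X < D ∧ ∀ d, D ≤ d → ∀ a x, a < x → x ≤ X → M.Hit x ![a, x, d] := by
  -- Service by the left facility persists for all positions of the left group; sending that group
  -- far away turns it into service by the right facility.
  obtain ⟨a₀, x₀, d₀, ha, hd, hg⟩ : ∃ a x d, a < x ∧ x < d ∧ M.g ![a, x, d] = x := by
    simp only [AvoidsMiddle, not_forall, not_not] at h
    obtain ⟨a, x, d, hax, hxd, hf | hg⟩ := h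
    · obtain ⟨A, hA, hA'⟩ := M.eventually_g_eq hxd fun a' ha' =>
        M.hit_of_f_eq hax hxd hf.symm a' x le_rfl ha'
      exact ⟨A, x, d, hA, hxd, hA' A le_rfl⟩
    · exact ⟨a, x, d, hax, hxd, hg.symm⟩
  have h1 := M.hit_of_g_eq ha hd hg
  set Y := max x₀ X with hY
  have hY1 : x₀ ≤ Y := le_max_left _ _
  obtain ⟨D, hD, hD'⟩ := M.eventually_f_eq (a := a₀) (x := Y) (by linarith) fun d hd' => h1 Y d hY1 hd'
  refine ⟨D, (le_max_right _ _).trans_lt hD, fun d hd' a x hax hx => ?_⟩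
  exact M.hit_of_f_eq (by linarith) (hD.trans_le hd') (hD' d hd') a x (hx.trans (le_max_right _ _)) hax

theorem eventually_hit_left (h : ¬ M.AvoidsMiddle) (X : ℝ) :
    ∃ A, A < X ∧ ∀ a, a ≤ A → ∀ x d, x < d → X ≤ x → M.Hit x ![a, x, d] := by
  obtain ⟨D, hD, hD'⟩ := M.mirror.eventually_hit_right (by rwa [mirror_avoidsMiddle]) (-X)
  refine ⟨-D, by linarith, fun a ha x d hxd hx => ?_⟩
  have := hD' (-a) (by linarith) (-d) (-x) (by linarith) (by linarith)
  simpa [mirror_hit] using this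

/-! ### Exchanging the left and the middle group -/

/-- The mechanism with the first two groups exchanged. -/
def swap : Nice (Fin 3) K := M.pull (Equiv.swap 0 1) (Equiv.surjective _)

theorem swap_hit (q a x d : ℝ) : M.swap.Hit q ![a, x, d] ↔ M.Hit q ![x, a, d] := by
  have : (![a, x, d] : Fin 3 → ℝ) ∘ (Equiv.swap 0 1 : Fin 3 ≃ Fin 3) = ![x, a, d] := by
    ext i
    fin_cases i <;> rfl
  rw [← this]; rfl

/-- Given the right group at `c`, and the groups `0` and `1` left of it: `u` is the position of the
group in the middle, and `z` a position of the left group where it gets a facility. -/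
def Gap (c u z : ℝ) : Prop := u ≤ 0 ∧ z < u ∧ M.Hit z ![z, u, c] ∧ M.Hit u ![z, u, c]

/-- Both facilities are used up at `z` and `u`, so the group at `c` pays at least `c`, while
covering by `u` and `c` has radius `u - z`. -/
theorem gap_lower_bound {c u z : ℝ} (h : M.Gap c u z) : c ≤ K * (u - z) := by
  obtain ⟨hu, hzu, hz, hu'⟩ := h
  obtain ⟨-, -, h3⟩ := M.ratio3 (a := z) (x := u) (d := c) u c (u - z)
    (Or.inl (by rw [abs_sub_comm, abs_of_pos (by linarith)])) (Or.inl (by simp [hzu.le]))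
    (Or.inr (by simp [hzu.le]))
  have hle := M.le ![z, u, c]
  have hfg : M.f ![z, u, c] = z ∧ M.g ![z, u, c] = u := by
    rcases hz with hz | hz <;> rcases hu' with hu' | hu' <;> constructor <;> linarith
  simp only [cost, hfg.1, hfg.2] at h3
  rcases min_le_iff.1 h3 with h | h <;> have := abs_le.1 h <;> linarith

theorem exists_gap {c : ℝ} (hc : 0 < c) (h : ∀ a x, a < x → x ≤ 0 → M.Hit x ![a, x, c]) :
    ∃ u z, M.Gap c u z := by
  have hK := mul_pos M.K_pos hc
  set a := -(2 * K * c + 1) with ha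
  obtain ⟨h1, -, -⟩ := M.ratio3 (a := a) (x := 0) (d := c) a 0 c (by simp [hc.le])
    (by simp [hc.le]) (Or.inr (by simp [abs_of_pos hc]))
  obtain ⟨q, hq, hqc⟩ := M.exists_hit a ![a, 0, c]
  rw [hqc] at h1
  have := abs_le.1 h1
  have hq0 : q < 0 := by linarith
  exact ⟨0, q, le_rfl, hq0, M.hit0 hq, h q 0 hq0 le_rfl⟩

theorem exists_smaller_gap {c u z m : ℝ} (hm : 0 < m)
    (h : ∀ a x, a < x → x ≤ 0 → M.Hit x ![a, x, c])
    (h' : ∀ a x, a < x → x ≤ 0 → M.swap.Hit x ![a, x, c])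
    (hmin : ∀ z', M.Gap c u z' → m ≤ u - z') (huz : M.Gap c u z) (hlt : u - z ≤ 3 / 2 * m) :
    ∃ u' z', M.swap.Gap c u' z' ∧ u' - z' < m := by
  obtain ⟨hu, hzu, hz, -⟩ := huz
  -- Group 0, reporting `x` slightly left of the midpoint, is served at some `q` with `z ≤ q < u`.
  -- Minimality gives `q ≤ u - m < x`. Moving group 1 onto `q` makes group 0 the middle one, with
  -- gap `x - q ≤ 5 / 8 * m`.
  set x := (z + u) / 2 - m / 8 with hx
  obtain ⟨q, hq, hqc⟩ := M.exists_hit x ![x, u, c]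
  have hzm := hmin z ⟨hu, hzu, hz, h z u hzu hu⟩
  have h1 : |x - q| ≤ |x - z| := hqc ▸ M.cost0.trans (M.cost_le_of_hit hz)
  rw [abs_of_nonneg (a := x - z) (by linarith)] at h1
  have h1' := abs_le.1 h1
  have hqu : q < u := by linarith
  have hqm := hmin q ⟨hu, hqu, M.hit0 hq, h q u hqu hu⟩
  have hqx : q < x := by linarith
  exact ⟨x, q, ⟨by linarith, hqx, (M.swap_hit _ _ _ _).2 (M.hit1 hq), h' q x hqx (by linarith)⟩,
    by linarith⟩

theorem swap_swap_hit (q a x d : ℝ) : M.swap.swap.Hit q ![a, x, d] ↔ M.Hit q ![a, x, d] := by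
  rw [swap_hit, swap_hit]

/-- If the groups `0` and `1` are left of the group `2`, they cannot both get a facility when they
are in the middle. -/
theorem avoidsMiddle_or_swap : M.AvoidsMiddle ∨ M.swap.AvoidsMiddle := by
  by_contra hcon
  obtain ⟨h1, h2⟩ := not_or.1 hcon
  obtain ⟨D₁, hD₁, H₁⟩ := M.eventually_hit_right h1 0
  obtain ⟨D₂, hD₂, H₂⟩ := M.swap.eventually_hit_right h2 0
  set c := max D₁ D₂ with hcdef
  have hc : 0 < c := lt_max_of_lt_left hD₁
  have h := H₁ c (le_max_left _ _)
  have h' := H₂ c (le_max_right _ _)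
  have h'' : ∀ a x, a < x → x ≤ 0 → M.swap.swap.Hit x ![a, x, c] := fun a x hax hx =>
    (M.swap_swap_hit _ _ _ _).2 (h a x hax hx)
  set S : Set ℝ := {t | ∃ u z, (M.Gap c u z ∨ M.swap.Gap c u z) ∧ t = u - z} with hS
  have hbound : ∀ t ∈ S, c / K ≤ t := by
    rintro _ ⟨u, z, hg | hg, rfl⟩
    · rw [div_le_iff₀' M.K_pos]; exact M.gap_lower_bound hg
    · rw [div_le_iff₀' M.K_pos]; exact M.swap.gap_lower_bound hg
  have hne : S.Nonempty := by
    obtain ⟨u, z, hg⟩ := M.exists_gap hc h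
    exact ⟨_, u, z, Or.inl hg, rfl⟩
  have hbdd : BddBelow S := ⟨_, hbound⟩
  have hm : 0 < sInf S := (div_pos hc M.K_pos).trans_le (le_csInf hne hbound)
  obtain ⟨_, ⟨u, z, hg, rfl⟩, hlt⟩ := exists_lt_of_csInf_lt hne
    (show sInf S < 3 / 2 * sInf S by linarith)
  have hmin : ∀ u z, (M.Gap c u z ∨ M.swap.Gap c u z) → sInf S ≤ u - z := fun u z hg =>
    csInf_le hbdd ⟨u, z, hg, rfl⟩
  rcases hg with hg | hg
  · obtain ⟨u', z', hg', hlt'⟩ := M.exists_smaller_gap hm h h' (fun z' hz' => hmin u z' (Or.inl hz'))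
      hg hlt.le
    exact absurd (hmin u' z' (Or.inr hg')) (not_le.2 hlt')
  · obtain ⟨u', z', hg', hlt'⟩ := M.swap.exists_smaller_gap hm h' h''
      (fun z' hz' => hmin u z' (Or.inr hz')) hg hlt.le
    have : M.Gap c u' z' := by
      obtain ⟨e1, e2, e3, e4⟩ := hg'
      exact ⟨e1, e2, (M.swap_swap_hit _ _ _ _).1 e3, (M.swap_swap_hit _ _ _ _).1 e4⟩
    exact absurd (hmin u' z' (Or.inl this)) (not_le.2 hlt')

end three

theorem reflect_hit (N : Nice ι K) (q : ℝ) (x : ι → ℝ) : N.reflect.Hit q x ↔ N.Hit (-q) (-x) := by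
  simp only [Hit, reflect]
  rw [or_comm, eq_neg_iff_add_eq_zero, eq_neg_iff_add_eq_zero, neg_eq_iff_add_eq_zero,
    neg_eq_iff_add_eq_zero]

/-- A facility strictly between the outer groups would remain when the middle group moves onto it.
-/
theorem AvoidsMiddle.le_or_le {M : Nice (Fin 3) K} (h : M.AvoidsMiddle) {a x d q : ℝ}
    (hq : M.Hit q ![a, x, d]) : q ≤ a ∨ d ≤ q := by
  by_contra hcon
  obtain ⟨h1, h2⟩ := not_or.1 hcon
  exact h a q d (not_le.1 h1) (not_le.1 h2) (M.hit1 hq)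

theorem AvoidsMiddle.hit_left {M : Nice (Fin 3) K} (h : M.AvoidsMiddle) {a x d : ℝ} (hax : a < x)
    (hxd : x - a < d - x) : M.Hit a ![a, x, d] := by
  obtain ⟨q, hq, hqc⟩ := M.exists_hit x ![a, x, d]
  have h1 : |x - q| ≤ |x - a| := hqc ▸ M.cost1.trans (M.cost_le_of_hit (M.hit_left_pair a d).1)
  rw [abs_of_pos (a := x - a) (by linarith)] at h1
  have := abs_le.1 h1
  rcases h.le_or_le hq with h2 | h2
  · obtain rfl : q = a := by linarith
    exact hq
  · linarith

theorem AvoidsMiddle.hit_right {M : Nice (Fin 3) K} (h : M.AvoidsMiddle) {a x d : ℝ} (hxd : x < d)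
    (hax : d - x < x - a) : M.Hit d ![a, x, d] := by
  have := (M.mirror_avoidsMiddle.2 h).hit_left (a := -d) (x := -x) (d := -a) (by linarith)
    (by linarith)
  simpa [mirror_hit] using this

/-! ### Sets of agents at three locations -/

section coalitions

/-- `P`, `X` and the set of the other agents partition the agents into three nonempty sets. -/
structure Splits (P X : Finset ι) : Prop where
  left : P.Nonempty
  middle : X.Nonempty
  disjoint : Disjoint P X
  right : ∃ i, i ∉ P ∧ i ∉ X

theorem Splits.symm {P X : Finset ι} (h : Splits P X) : Splits X P :=
  ⟨h.middle, h.left, h.disjoint.symm, h.right.imp fun _ hi => hi.symm⟩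

variable [DecidableEq ι] (N : Nice ι K) {P Q X Y : Finset ι}

/-- The agents in `P` are on the left, those in `X` in the middle, and the others on the right. -/
def place (P X : Finset ι) (i : ι) : Fin 3 := if i ∈ P then 0 else if i ∈ X then 1 else 2

theorem Splits.surjective (h : Splits P X) : Function.Surjective (place P X) := by
  obtain ⟨p, hp⟩ := h.left
  obtain ⟨x, hx⟩ := h.middle
  obtain ⟨d, hd, hd'⟩ := h.right
  have hx' : x ∉ P := Finset.disjoint_right.1 h.disjoint hx
  intro k
  fin_cases k
  · exact ⟨p, by simp [place, hp]⟩
  · exact ⟨x, by simp [place, hx, hx']⟩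
  · exact ⟨d, by simp [place, hd, hd']⟩

/-- With `P` on the left, `X` in the middle and the other agents on the right, there is never a
facility at the location of `X`. -/
def Avoids (P X : Finset ι) : Prop :=
  ∀ a x d : ℝ, a < x → x < d → ¬ N.Hit x (![a, x, d] ∘ place P X)

theorem avoids_or_avoids (h : Splits P X) : N.Avoids P X ∨ N.Avoids X P := by
  rcases (N.pull _ h.surjective).avoidsMiddle_or_swap with h' | h'
  · exact Or.inl h'
  · refine Or.inr fun a x d hax hxd hhit => h' a x d hax hxd ?_
    rw [swap_hit]
    have : (![a, x, d] : Fin 3 → ℝ) ∘ place X P = ![x, a, d] ∘ place P X := by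
      ext i
      by_cases hP : i ∈ P
      · simp [place, hP, Finset.disjoint_left.1 h.disjoint hP]
      · by_cases hX : i ∈ X <;> simp [place, hP, hX]
    rwa [this] at hhit

/-- If `Q` did not avoid `X`, then for distant `d` there would be facilities at 1, by
`eventually_hit_right`, and at 0, inherited from `P` when the rest of `Q` joins it. None is left for
`d`. -/
theorem Avoids.mono (h : N.Avoids P X) (hP : P.Nonempty) (hPQ : P ⊆ Q) (hQ : Splits Q X) :
    N.Avoids Q X := by
  by_contra hcon
  have hPs : Splits P X := ⟨hP, hQ.middle, hQ.disjoint.mono_left hPQ,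
    hQ.right.imp fun i hi => ⟨fun h => hi.1 (hPQ h), hi.2⟩⟩
  obtain ⟨D, hD, hD'⟩ := (N.pull _ hQ.surjective).eventually_hit_right hcon 1
  have hK := N.K_pos
  set d := max D (K + 3) with hd
  have hdK : K + 3 ≤ d := le_max_right _ _
  have h1 : N.Hit 1 (![0, 1, d] ∘ place Q X) := hD' d (le_max_left _ _) 0 1 one_pos le_rfl
  have h0 : N.Hit 0 (![0, 1, d] ∘ place P X) :=
    AvoidsMiddle.hit_left (M := N.pull _ hPs.surjective) h one_pos (by linarith)
  have h0' : N.Hit 0 (![0, 1, d] ∘ place Q X) := h0.move fun i => by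
    by_cases hiQ : i ∈ Q
    · simp [place, hiQ]
    · have : i ∉ P := fun h => hiQ (hPQ h)
      simp [place, hiQ, this]
  obtain ⟨-, -, h3⟩ := (N.pull _ hQ.surjective).ratio3 (a := 0) (x := 1) (d := d) 1 d 1
    (by simp) (by simp) (by simp)
  obtain ⟨q, hq, hqc⟩ := (N.pull _ hQ.surjective).exists_hit d ![0, 1, d]
  rw [hqc] at h3
  have := abs_le.1 h3
  change N.Hit q (![0, 1, d] ∘ place Q X) at hq
  rcases hq with hq | hq <;> rcases h1 with h1 | h1 <;> rcases h0' with h0' | h0' <;> linarith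

theorem reflect_avoids [Fintype ι] (h : Splits P X) :
    N.reflect.Avoids (P ∪ X)ᶜ X ↔ N.Avoids P X := by
  have key : ∀ a x d : ℝ, -((![a, x, d] : Fin 3 → ℝ) ∘ place (P ∪ X)ᶜ X) =
      ![-d, -x, -a] ∘ place P X := by
    intro a x d
    ext i
    by_cases hP : i ∈ P
    · simp [place, hP, Finset.disjoint_left.1 h.disjoint hP]
    · by_cases hX : i ∈ X <;> simp [place, hP, hX]
  constructor
  · intro H a x d hax hxd hhit
    refine H (-d) (-x) (-a) (by linarith) (by linarith) ?_
    rw [reflect_hit, key]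
    simpa using hhit
  · intro H a x d hax hxd hhit
    rw [reflect_hit, key] at hhit
    exact H (-d) (-x) (-a) (by linarith) (by linarith) hhit

theorem Splits.compl [Fintype ι] (h : Splits P X) : Splits (P ∪ X)ᶜ X := by
  refine ⟨?_, h.middle, ?_, ?_⟩
  · obtain ⟨i, hi, hi'⟩ := h.right
    exact ⟨i, by simp [hi, hi']⟩
  · rw [Finset.disjoint_left]
    intro i hi hX
    simp [hX] at hi
  · obtain ⟨i, hi⟩ := h.left
    exact ⟨i, by simp [hi], Finset.disjoint_left.1 h.disjoint hi⟩

theorem Avoids.anti [Fintype ι] (h : N.Avoids P X) (hP : Splits P X) (hQP : Q ⊆ P)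
    (hQ : Q.Nonempty) : N.Avoids Q X := by
  have hQs : Splits Q X := ⟨hQ, hP.middle, hP.disjoint.mono_left hQP,
    hP.right.imp fun i hi => ⟨fun h => hi.1 (hQP h), hi.2⟩⟩
  rw [← N.reflect_avoids hQs]
  rw [← N.reflect_avoids hP] at h
  exact h.mono N.reflect hP.compl.left
    (Finset.compl_subset_compl.2 (Finset.union_subset_union_left hQP)) hQs.compl

/-- If there are at least three agents outside of `X`, it does not matter how they are distributed
to the left and to the right of `X`. -/
theorem Avoids.of_avoids [Fintype ι] (h : N.Avoids P X) (hP : Splits P X) (hQ : Splits Q X)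
    (hX : 3 ≤ Xᶜ.card) : N.Avoids Q X := by
  -- the step through a common subset, or through a union that leaves an agent on the right
  have inter : ∀ {P Q : Finset ι}, N.Avoids P X → Splits P X → Splits Q X → (P ∩ Q).Nonempty →
      N.Avoids Q X := fun h hP hQ hPQ =>
    (h.anti N hP Finset.inter_subset_left hPQ).mono N hPQ Finset.inter_subset_right hQ
  by_cases hPQ : (P ∩ Q).Nonempty
  · exact inter h hP hQ hPQ
  obtain ⟨p, hp⟩ := hP.left
  obtain ⟨q, hq⟩ := hQ.left
  have hpX := Finset.disjoint_left.1 hP.disjoint hp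
  have hqX := Finset.disjoint_left.1 hQ.disjoint hq
  have hR : Splits {p, q} X := by
    refine ⟨⟨p, by simp⟩, hP.middle, ?_, ?_⟩
    · rw [Finset.disjoint_left]
      intro i hi
      rcases Finset.mem_insert.1 hi with rfl | hi
      · exact hpX
      · rw [Finset.mem_singleton.1 hi]; exact hqX
    · by_contra hcon
      have : Xᶜ ⊆ {p, q} := fun i hi => by
        by_contra hi'
        exact hcon ⟨i, hi', by simpa using hi⟩
      have := (Finset.card_le_card this).trans Finset.card_le_two
      omega
  exact inter (inter h hP hR ⟨p, by simp [hp]⟩) hR hQ ⟨q, by simp [hq]⟩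

/-- Otherwise put `X` far left, `A` at 0, `B` at 1 and the others at 3. The three hypotheses on
avoidance give cost at most 1 at 0, at most 2 at 3, and at least 1 at 1. So there are facilities in
`[-1, 0]` and in `[2, 5]`, and `X` needs a third one. -/
theorem not_avoids_of_avoids {A B X : Finset ι} (hA : A.Nonempty) (hX : X.Nonempty)
    (hAB : Disjoint A B) (hXA : Disjoint X A) (hXB : Disjoint X B)
    (hC : ∃ i, i ∉ A ∧ i ∉ B ∧ i ∉ X) (h1 : ¬ N.Avoids X (A ∪ B)) (h2 : N.Avoids A (X ∪ B)) :
    ¬ N.Avoids X A := by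
  intro h3
  obtain ⟨c, hcA, hcB, hcX⟩ := hC
  have s1 : Splits X (A ∪ B) := ⟨hX, hA.mono Finset.subset_union_left,
    Finset.disjoint_union_right.2 ⟨hXA, hXB⟩, c, hcX, by simp [hcA, hcB]⟩
  have s2 : Splits A (X ∪ B) := ⟨hA, hX.mono Finset.subset_union_left,
    Finset.disjoint_union_right.2 ⟨hXA.symm, hAB⟩, c, hcA, by simp [hcX, hcB]⟩
  have s3 : Splits X A := ⟨hX, hA, hXA, c, hcX, hcA⟩
  obtain ⟨D, hD, hD'⟩ := (N.pull _ s1.surjective).eventually_hit_left h1 1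
  have hK := N.K_pos
  set a := min D (-(3 * K + 3)) with ha
  have haD : a ≤ D := min_le_left _ _
  have haK : a ≤ -(3 * K + 3) := min_le_right _ _
  set v : ι → ℝ := fun i => if i ∈ X then a else if i ∈ A then 0 else if i ∈ B then 1 else 3 with hv
  have e1 : N.Hit 1 (![a, 1, 3] ∘ place X (A ∪ B)) := hD' a haD 1 3 (by norm_num) le_rfl
  have e3 : N.Hit 1 (![a, 0, 1] ∘ place X A) :=
    AvoidsMiddle.hit_right (M := N.pull _ s3.surjective) h3 one_pos (by linarith)
  have nAX : ∀ i ∈ A, i ∉ X := fun i hi => Finset.disjoint_right.1 hXA hi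
  have nBX : ∀ i ∈ B, i ∉ X := fun i hi => Finset.disjoint_right.1 hXB hi
  have nBA : ∀ i ∈ B, i ∉ A := fun i hi => Finset.disjoint_right.1 hAB hi
  have c0 : N.cost 0 v ≤ |0 - 1| := N.cost_le_of_option (fun i => by
    by_cases hiA : i ∈ A
    · simp [hv, hiA, nAX i hiA]
    · by_cases hiX : i ∈ X
      · simp [hv, hiX, place]
      · by_cases hiB : i ∈ B <;> simp [hv, hiX, hiA, hiB, place]) e1
  have c3 : N.cost 3 v ≤ |3 - 1| := N.cost_le_of_option (fun i => by
    by_cases hiA : i ∈ A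
    · simp [hv, hiA, nAX i hiA, place]
    · by_cases hiX : i ∈ X
      · simp [hv, hiX, place]
      · by_cases hiB : i ∈ B <;> simp [hv, hiX, hiA, hiB, place]) e3
  have c1 : 1 ≤ N.cost 1 v := by
    obtain ⟨q, hq, hqc⟩ := N.exists_hit 1 (![0, 1, 3] ∘ place A (X ∪ B))
    have hle : N.cost 1 (![0, 1, 3] ∘ place A (X ∪ B)) ≤ N.cost 1 v := N.cost_le_cost fun i => by
      by_cases hiA : i ∈ A
      · simp [hv, hiA, nAX i hiA, place]
      · by_cases hiX : i ∈ X
        · simp [hv, hiX, hiA, place]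
        · by_cases hiB : i ∈ B <;> simp [hv, hiX, hiA, hiB, place]
    refine le_trans ?_ hle
    rw [hqc]
    rcases AvoidsMiddle.le_or_le (M := N.pull _ s2.surjective) h2 hq with h | h
    · rw [abs_of_nonneg (by linarith)]; linarith
    · rw [abs_of_nonpos (by linarith)]; linarith
  obtain ⟨x, hx⟩ := hX
  have ca : N.cost a v ≤ K * 3 := by
    have := N.cost_le_ratio (x := v) a 0 3 (fun i => by
      by_cases hiX : i ∈ X
      · simp [hv, hiX]
      · by_cases hiA : i ∈ A
        · simp [hv, hiX, hiA]
        · by_cases hiB : i ∈ B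
          · right; simp [hv, hiX, hiA, hiB]
          · right; simp [hv, hiX, hiA, hiB]) x
    simpa [hv, hx] using this
  have away : ∀ q, N.Hit q v → q ≤ 0 ∨ 2 ≤ q := by
    intro q hq
    have := c1.trans (N.cost_le_of_hit hq)
    rcases le_abs.1 this with h | h
    · left; linarith
    · right; linarith
  obtain ⟨q₀, hq₀, e₀⟩ := N.exists_hit 0 v
  obtain ⟨q₃, hq₃, e₃⟩ := N.exists_hit 3 v
  obtain ⟨q, hq, e⟩ := N.exists_hit a v
  rw [e₀] at c0
  rw [e₃] at c3
  rw [e] at ca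
  norm_num at c0 c3
  have b0 := abs_le.1 c0
  have b3 := abs_le.1 c3
  have b := abs_le.1 ca
  have w0 := away _ hq₀
  have w3 := away _ hq₃
  have g0 : q₀ ≤ 0 := by rcases w0 with h | h <;> linarith
  have g3 : 2 ≤ q₃ := by rcases w3 with h | h <;> linarith
  rcases hq₀ with h | h <;> rcases hq₃ with h' | h' <;> rcases hq with h'' | h'' <;> linarith

/-- With at least five agents, some set of all but two agents, placed between the other two, gets
no facility at its location. -/
theorem exists_avoids [Fintype ι] (hn : 5 ≤ Fintype.card ι) :
    ∃ P X : Finset ι, Splits P X ∧ X.card = Fintype.card ι - 2 ∧ N.Avoids P X := by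
  by_contra hcon
  push Not at hcon
  -- the sets that get a facility in the middle of some profile, for all positions of the others
  let D : Finset ι → Prop := fun X => X.Nonempty ∧ ∀ P, Splits P X → ¬ N.Avoids P X
  have hD : ∀ X : Finset ι, X.card = Fintype.card ι - 2 → D X := fun X hX =>
    ⟨Finset.card_pos.1 (by omega), fun P hP => hcon P X hP hX⟩
  have hdisj : ∀ X Y, D X → D Y → Disjoint X Y → ¬ ∃ i, i ∉ X ∧ i ∉ Y := by
    intro X Y hX hY hXY hi
    have hs : Splits X Y := ⟨hX.1, hY.1, hXY, hi⟩
    rcases N.avoids_or_avoids hs with h | h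
    · exact hY.2 X hs h
    · exact hX.2 Y hs.symm h
  have hex : ∃ m, ∃ S : Finset ι, S.card = m ∧ D S := by
    obtain ⟨S, -, hS⟩ := Finset.exists_subset_card_eq
      (show Fintype.card ι - 2 ≤ (Finset.univ : Finset ι).card by rw [Finset.card_univ]; omega)
    exact ⟨_, S, rfl, hD S hS⟩
  classical
  obtain ⟨S, hSm, hS⟩ := Nat.find_spec hex
  have hmin : ∀ T : Finset ι, T.card < S.card → ¬ D T := fun T hT hDT =>
    Nat.find_min hex (by rwa [← hSm]) ⟨T, rfl, hDT⟩
  have hSn : S.card ≤ Fintype.card ι - 2 := by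
    by_contra hlt
    obtain ⟨T, -, hT⟩ := Finset.exists_subset_card_eq
      (show Fintype.card ι - 2 ≤ (Finset.univ : Finset ι).card by rw [Finset.card_univ]; omega)
    exact hmin T (by omega) (hD T hT)
  have hSc : 2 ≤ Sᶜ.card := by rw [Finset.card_compl]; omega
  have hS1 : 0 < S.card := Finset.card_pos.2 hS.1
  -- A decisive singleton and a disjoint decisive set of n - 2 agents would leave one agent over.
  have hS2 : 1 < S.card := by
    by_contra hle
    obtain ⟨T, hT, hTc⟩ := Finset.exists_subset_card_eq
      (show Fintype.card ι - 2 ≤ Sᶜ.card by rw [Finset.card_compl]; omega)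
    have hST : Disjoint S T := Finset.disjoint_left.2 fun i hi hi' => by
      simpa [hi] using hT hi'
    refine hdisj S T hS (hD T hTc) hST ?_
    by_contra hcon'
    have : (Finset.univ : Finset ι) ⊆ S ∪ T := fun i _ => by
      by_contra hi
      exact hcon' ⟨i, by simpa [not_or] using hi⟩
    have := (Finset.card_le_card this).trans (Finset.card_union_le _ _)
    rw [Finset.card_univ] at this
    omega
  -- `S.erase b` is too small to be decisive, so `{x}` on its left avoids it. If `{b, x}` were
  -- avoided too, `not_avoids_of_avoids` would contradict this, because `S` is decisive.
  have hpair : ∀ b ∈ S, ∀ x ∉ S, D {b, x} := by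
    intro b hb x hx
    have hbx : b ≠ x := fun h => hx (h ▸ hb)
    refine ⟨⟨b, by simp⟩, fun Q hQ hav => ?_⟩
    set A := S.erase b with hA
    have hAcard : A.card = S.card - 1 := Finset.card_erase_of_mem hb
    have hAne : A.Nonempty := Finset.card_pos.1 (by omega)
    have hxA : x ∉ A := fun h => hx (Finset.mem_of_mem_erase h)
    have hbA : b ∉ A := Finset.notMem_erase b S
    obtain ⟨c, hc, hcx⟩ : ∃ c ∈ Sᶜ, c ≠ x := Finset.exists_mem_ne hSc x
    rw [Finset.mem_compl] at hc
    have hcA : c ∉ A := fun h => hc (Finset.mem_of_mem_erase h)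
    have hcb : c ≠ b := fun h => hc (h ▸ hb)
    have hAb : A ∪ {b} = S := by
      rw [hA, Finset.union_comm, ← Finset.insert_eq, Finset.insert_erase hb]
    have sA : Splits {x} A := ⟨⟨x, by simp⟩, hAne, by simpa using hxA, c, by simpa using hcx, hcA⟩
    have sS : Splits {x} S := ⟨⟨x, by simp⟩, hS.1, by simpa using hx, c, by simpa using hcx, hc⟩
    have hA3 : 3 ≤ Aᶜ.card := by rw [Finset.card_compl]; omega
    have hxA' : N.Avoids {x} A := by
      have hnA := hmin A (by omega)
      have : ∃ P, Splits P A ∧ N.Avoids P A := by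
        by_contra hno
        exact hnA ⟨hAne, fun P hP h => hno ⟨P, hP, h⟩⟩
      obtain ⟨P, hP, h⟩ := this
      exact h.of_avoids N hP sA hA3
    have hbx2 : ({b, x} : Finset ι).card = 2 := Finset.card_pair hbx
    have sbx : Splits A {b, x} := by
      refine ⟨hAne, ⟨b, by simp⟩, ?_, c, hcA, by simp [hcb, hcx]⟩
      rw [Finset.disjoint_right]
      intro i hi
      rcases Finset.mem_insert.1 hi with rfl | hi
      · exact hbA
      · rw [Finset.mem_singleton.1 hi]; exact hxA
    have h2 : N.Avoids A ({x} ∪ {b}) := by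
      rw [Finset.union_comm, ← Finset.insert_eq]
      exact hav.of_avoids N hQ sbx (by rw [Finset.card_compl]; omega)
    refine N.not_avoids_of_avoids (A := A) (B := {b}) (X := {x}) hAne ⟨x, by simp⟩
      (by simpa using hbA) (by simpa using hxA) (by simpa using hbx.symm)
      ⟨c, hcA, by simpa using hcb, by simpa using hcx⟩ ?_ h2 hxA'
    rw [hAb]
    exact hS.2 _ sS
  obtain ⟨b, hb, b', hb', hbb⟩ := Finset.one_lt_card.1 hS2
  obtain ⟨x, hx, x', hx', hxx⟩ := Finset.one_lt_card.1 (show 1 < Sᶜ.card from hSc)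
  rw [Finset.mem_compl] at hx hx'
  have hbx' : b ≠ x' := fun h => hx' (h ▸ hb)
  have hxb' : x ≠ b' := fun h => hx (h ▸ hb')
  refine hdisj _ _ (hpair b hb x hx) (hpair b' hb' x' hx') ?_ ?_
  · rw [Finset.disjoint_left]
    intro i hi
    rcases Finset.mem_insert.1 hi with rfl | hi
    · simp [hbb, hbx']
    · rw [Finset.mem_singleton.1 hi]; simp [hxx, hxb']
  · by_contra hno
    have hsub : (Finset.univ : Finset ι) ⊆ {b, x} ∪ {b', x'} := fun i _ => by
      by_contra hi
      exact hno ⟨i, by simpa only [Finset.mem_union, not_or] using hi⟩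
    have h4 := (Finset.card_le_card hsub).trans (Finset.card_union_le _ _)
    have h5 : ({b, x} : Finset ι).card ≤ 2 := Finset.card_le_two
    have h6 : ({b', x'} : Finset ι).card ≤ 2 := Finset.card_le_two
    rw [Finset.card_univ] at h4
    omega

end coalitions

end Nice

/-! ### From mechanisms to `Nice`, and the lower bound -/

theorem agentCost_two (a : ℝ) (y : Fin 2 → ℝ) : agentCost a y = min |a - y 0| |a - y 1| := by
  refine le_antisymm (le_min (Finset.inf'_le _ (Finset.mem_univ 0))
    (Finset.inf'_le _ (Finset.mem_univ 1))) (Finset.le_inf' _ _ fun l _ => ?_)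
  fin_cases l
  · exact min_le_left _ _
  · exact min_le_right _ _

theorem agentCost_nonneg (a : ℝ) (y : Fin 2 → ℝ) : 0 ≤ agentCost a y := by
  rw [agentCost_two]; exact le_min (abs_nonneg _) (abs_nonneg _)

theorem socialCost_nonneg {n : ℕ} (x : Fin n → ℝ) (y : Fin 2 → ℝ) : 0 ≤ socialCost x y :=
  Finset.sum_nonneg fun _ _ => agentCost_nonneg _ _

theorem optCost_le {n : ℕ} (x : Fin n → ℝ) (y : Fin 2 → ℝ) : optCost 2 x ≤ socialCost x y :=
  ciInf_le ⟨0, by rintro _ ⟨y, rfl⟩; exact socialCost_nonneg x y⟩ y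

/-- Strategyproofness extends to coalitions of agents at the same location. -/
theorem Mechanism.Strategyproof.coalition {n : ℕ} {F : Mechanism n 2} (hF : F.Strategyproof)
    (x y : Fin n → ℝ) (p : ℝ) (h : ∀ i, x i = p ∨ x i = y i) :
    agentCost p (F.outcome x) ≤ agentCost p (F.outcome y) := by
  suffices H : ∀ s : Finset (Fin n), ∀ x : Fin n → ℝ, (∀ i, x i = p ∨ x i = y i) →
      (∀ i, i ∉ s → x i = y i) → agentCost p (F.outcome x) ≤ agentCost p (F.outcome y) from
    H Finset.univ x h fun i hi => absurd (Finset.mem_univ i) hi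
  intro s
  induction s using Finset.induction with
  | empty =>
    intro x _ hx
    rw [funext fun i => hx i (Finset.notMem_empty i)]
  | insert a s _ ih =>
    intro x h hx
    have hz := ih (Function.update x a (y a))
      (fun i => by
        rcases eq_or_ne i a with rfl | hi
        · simp
        · simpa [hi] using h i)
      (fun i his => by
        rcases eq_or_ne i a with rfl | hi
        · simp
        · simpa [hi] using hx i (by simp [hi, his]))
    -- Coalition members misreport one at a time; if agent `a` is at `p`, truthfulness compares `x`
    -- with the profile in which only she has deviated.
    rcases h a with ha | ha
    · have := hF x a (y a)
      rw [ha] at this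
      exact this.trans hz
    · rwa [← ha, Function.update_eq_self] at hz

theorem Mechanism.HasApproxRatio.socialCost_le {n : ℕ} {F : Mechanism n 2} {ρ : ℝ}
    (h : F.HasApproxRatio ρ) (x : Fin n → ℝ) (y : Fin 2 → ℝ) :
    socialCost x (F.outcome x) ≤ ρ * socialCost x y :=
  (h.2 x).trans (mul_le_mul_of_nonneg_left (optCost_le x y) (zero_le_one.trans h.1))

/-- A strategyproof mechanism with a bounded approximation ratio. -/
def Mechanism.toNice {n : ℕ} (hn : 0 < n) (F : Mechanism n 2) (hF : F.Strategyproof) {ρ : ℝ}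
    (hρ : F.HasApproxRatio ρ) : Nice (Fin n) (ρ * n) where
  f x := F.outcome x 0
  g x := F.outcome x 1
  le x := F.sorted x zero_le_one
  sp x y p h := by
    have := hF.coalition x y p h
    rwa [agentCost_two, agentCost_two] at this
  one_le := by
    have : (1 : ℝ) ≤ n := by exact_mod_cast hn
    exact one_le_mul_of_one_le_of_one_le hρ.1 this
  ratio x y₁ y₂ δ h i := by
    rw [← agentCost_two]
    calc agentCost (x i) (F.outcome x)
        ≤ socialCost x (F.outcome x) := Finset.single_le_sum
          (f := fun j => agentCost (x j) (F.outcome x)) (fun j _ => agentCost_nonneg _ _)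
          (Finset.mem_univ i)
      _ ≤ ρ * socialCost x ![y₁, y₂] := hρ.socialCost_le x _
      _ ≤ ρ * (n * δ) := by
          refine mul_le_mul_of_nonneg_left ?_ (zero_le_one.trans hρ.1)
          have : socialCost x ![y₁, y₂] ≤ ∑ _j : Fin n, δ := Finset.sum_le_sum fun j _ => by
            rw [agentCost_two]
            exact min_le_iff.2 (h j)
          simpa using this
      _ = ρ * n * δ := by ring

theorem Mechanism.HasApproxRatio.sub_two_le {n : ℕ} (hn : 5 ≤ n) {F : Mechanism n 2}
    (hF : F.Strategyproof) {ρ : ℝ} (hρ : F.HasApproxRatio ρ) : (n : ℝ) - 2 ≤ ρ := by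
  obtain ⟨P, X, hs, hX, hav⟩ := (F.toNice (by omega) hF hρ).exists_avoids (by simpa using hn)
  rw [Fintype.card_fin] at hX
  set v : Fin n → ℝ := ![0, 1, 3] ∘ Nice.place P X with hv
  have hnX : ∀ i ∈ X, i ∉ P := fun i hi => Finset.disjoint_right.1 hs.disjoint hi
  have hPc : P.card ≤ 1 := by
    obtain ⟨d, hdP, hdX⟩ := hs.right
    have h1 : (P ∪ X).card < n := by
      have : P ∪ X ⊂ Finset.univ :=
        (Finset.ssubset_univ_iff).2 fun h => by
          have := Finset.mem_univ d
          rw [← h, Finset.mem_union] at this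
          exact this.elim hdP hdX
      simpa using Finset.card_lt_card this
    rw [Finset.card_union_of_disjoint hs.disjoint] at h1
    omega
  have hlow : (n : ℝ) - 2 ≤ socialCost v (F.outcome v) := by
    have h1 : ∀ i ∈ X, 1 ≤ agentCost (v i) (F.outcome v) := by
      intro i hi
      have hvi : v i = 1 := by simp [hv, Nice.place, hnX i hi, hi]
      obtain ⟨q, hq, hqc⟩ := (F.toNice (by omega) hF hρ).exists_hit 1 v
      have hcost : agentCost (v i) (F.outcome v) = |1 - q| := by
        rw [agentCost_two, hvi]; exact hqc
      rw [hcost]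
      rcases Nice.AvoidsMiddle.le_or_le
        (M := (F.toNice (by omega) hF hρ).pull _ hs.surjective) hav hq with h | h
      · rw [abs_of_nonneg (by linarith)]; linarith
      · rw [abs_of_nonpos (by linarith)]; linarith
    have h2 : ∑ i ∈ X, (1 : ℝ) ≤ socialCost v (F.outcome v) :=
      (Finset.sum_le_sum h1).trans (Finset.sum_le_sum_of_subset_of_nonneg (Finset.subset_univ X)
        fun i _ _ => agentCost_nonneg _ _)
    rw [Finset.sum_const, nsmul_eq_mul, mul_one, hX, Nat.cast_sub (by omega)] at h2
    simpa using h2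
  have hup : socialCost v ![1, 3] ≤ 1 := by
    have h1 : ∀ i, agentCost (v i) ![1, 3] ≤ if i ∈ P then 1 else 0 := by
      intro i
      rw [agentCost_two]
      by_cases hiP : i ∈ P
      · simp [hv, Nice.place, hiP]
      · by_cases hiX : i ∈ X <;> simp [hv, Nice.place, hiP, hiX]
    have h2 : socialCost v ![1, 3] ≤ ∑ i, if i ∈ P then (1 : ℝ) else 0 :=
      Finset.sum_le_sum fun i _ => h1 i
    have h3 : ∑ i, (if i ∈ P then (1 : ℝ) else 0) = P.card := by simp
    have h4 : (P.card : ℝ) ≤ 1 := by exact_mod_cast hPc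
    linarith
  calc (n : ℝ) - 2 ≤ ρ * socialCost v ![1, 3] := hlow.trans (hρ.socialCost_le v _)
    _ ≤ ρ * 1 := mul_le_mul_of_nonneg_left hup (zero_le_one.trans hρ.1)
    _ = ρ := mul_one ρ

/-! ### The Two-Extremes mechanism -/

theorem agentCost_twoExtremes {n : ℕ} (a : ℝ) (x : Fin n → ℝ) :
    agentCost a ((twoExtremes n).outcome x) = min |a - ⨅ i, x i| |a - ⨆ i, x i| := by
  rw [agentCost_two]; rfl

/-- An agent at an extreme pays nothing, and any other agent can only push the facilities outward,
away from herself. -/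
theorem twoExtremes_strategyproof (n : ℕ) : (twoExtremes n).Strategyproof := by
  intro x i z
  have : Nonempty (Fin n) := ⟨i⟩
  rw [agentCost_twoExtremes, agentCost_twoExtremes]
  obtain ⟨p, hp⟩ := exists_eq_ciInf_of_finite (f := x)
  obtain ⟨q, hq⟩ := exists_eq_ciSup_of_finite (f := x)
  have hpi : x p ≤ x i := hp ▸ ciInf_le (Set.finite_range x).bddBelow i
  have hiq : x i ≤ x q := hq ▸ le_ciSup (Set.finite_range x).bddAbove i
  rw [← hp, ← hq]
  rcases eq_or_ne p i with rfl | hpi'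
  · simp
  rcases eq_or_ne q i with rfl | hqi'
  · simp
  have h1 : ⨅ j, Function.update x i z j ≤ x p := by
    simpa [hpi'] using ciInf_le (Set.finite_range (Function.update x i z)).bddBelow p
  have h2 : x q ≤ ⨆ j, Function.update x i z j := by
    simpa [hqi'] using le_ciSup (Set.finite_range (Function.update x i z)).bddAbove q
  refine min_le_min ?_ ?_
  · rw [abs_of_nonneg (by linarith), abs_of_nonneg (by linarith)]; linarith
  · rw [abs_of_nonpos (by linarith), abs_of_nonpos (by linarith)]; linarith

/-- Two of the three points `a`, `b`, `c` share a facility. -/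
theorem min_sub_le_agentCost_add {a b c : ℝ} (hbc : b ≤ c) (y : Fin 2 → ℝ) :
    min (b - a) (c - b) ≤ agentCost a y + agentCost b y + agentCost c y := by
  simp only [agentCost_two]
  have d : ∀ s t u : ℝ, t - s ≤ |s - u| + |t - u| := fun s t u => by
    have := neg_abs_le (s - u)
    have := le_abs_self (t - u)
    linarith
  have n : ∀ t : ℝ, 0 ≤ |t| := abs_nonneg
  have m1 := min_le_left (b - a) (c - b)
  have m2 := min_le_right (b - a) (c - b)
  rcases min_choice |a - y 0| |a - y 1| with h1 | h1 <;>
  rcases min_choice |b - y 0| |b - y 1| with h2 | h2 <;>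
  rcases min_choice |c - y 0| |c - y 1| with h3 | h3 <;>
  rw [h1, h2, h3] <;>
  linarith [d a b (y 0), d a b (y 1), d b c (y 0), d b c (y 1), d a c (y 0), d a c (y 1),
    n (a - y 0), n (a - y 1), n (b - y 0), n (b - y 1), n (c - y 0), n (c - y 1)]

theorem twoExtremes_socialCost_le {n : ℕ} (hn : 2 ≤ n) (x : Fin n → ℝ) (y : Fin 2 → ℝ) :
    socialCost x ((twoExtremes n).outcome x) ≤ ((n : ℝ) - 2) * socialCost x y := by
  have : Nonempty (Fin n) := ⟨⟨0, by omega⟩⟩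
  have hn' : (0 : ℝ) ≤ (n : ℝ) - 2 := sub_nonneg.2 (by exact_mod_cast hn)
  obtain ⟨p, hp⟩ := exists_eq_ciInf_of_finite (f := x)
  obtain ⟨q, hq⟩ := exists_eq_ciSup_of_finite (f := x)
  have hpi : ∀ i, x p ≤ x i := fun i => hp ▸ ciInf_le (Set.finite_range x).bddBelow i
  have hiq : ∀ i, x i ≤ x q := fun i => hq ▸ le_ciSup (Set.finite_range x).bddAbove i
  have hcost : ∀ i, agentCost (x i) ((twoExtremes n).outcome x) = min (x i - x p) (x q - x i) := by
    intro i
    rw [agentCost_twoExtremes, ← hp, ← hq, abs_of_nonneg (sub_nonneg.2 (hpi i)),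
      abs_of_nonpos (sub_nonpos.2 (hiq i)), neg_sub]
  rcases eq_or_ne p q with hpq | hpq
  · have : socialCost x ((twoExtremes n).outcome x) ≤ 0 := Finset.sum_nonpos fun i _ => by
      rw [hcost]
      have := hiq i
      rw [← hpq] at this
      exact (min_le_left _ _).trans (by linarith)
    exact this.trans (mul_nonneg hn' (socialCost_nonneg x y))
  -- Each of the n - 2 remaining agents pays at most the whole cost of `y`, already incurred by her
  -- and the two extreme agents.
  have hle : ∀ i ∈ ({p, q} : Finset (Fin n))ᶜ,
      agentCost (x i) ((twoExtremes n).outcome x) ≤ socialCost x y := by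
    intro i hi
    simp only [Finset.mem_compl, Finset.mem_insert, Finset.mem_singleton, not_or] at hi
    rw [hcost]
    refine (min_sub_le_agentCost_add (hiq i) y).trans ?_
    have h1 : ∑ j ∈ ({p, i, q} : Finset (Fin n)), agentCost (x j) y ≤ socialCost x y :=
      Finset.sum_le_sum_of_subset_of_nonneg (Finset.subset_univ _)
        fun j _ _ => agentCost_nonneg _ _
    rw [Finset.sum_insert (by simp [Ne.symm hi.1, hpq]), Finset.sum_insert (by simp [hi.2]),
      Finset.sum_singleton] at h1
    linarith
  have hsplit : socialCost x ((twoExtremes n).outcome x) =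
      ∑ i ∈ ({p, q} : Finset (Fin n))ᶜ, agentCost (x i) ((twoExtremes n).outcome x) := by
    unfold socialCost
    rw [← Finset.sum_add_sum_compl ({p, q} : Finset (Fin n)), Finset.sum_pair hpq, hcost, hcost]
    simp [hpi q]
  have hcard : ((({p, q} : Finset (Fin n))ᶜ).card : ℝ) = (n : ℝ) - 2 := by
    rw [Finset.card_compl, Finset.card_pair hpq, Fintype.card_fin, Nat.cast_sub hn]
    simp
  rw [hsplit]
  refine (Finset.sum_le_card_nsmul _ _ _ hle).trans ?_
  rw [nsmul_eq_mul, hcard]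

theorem twoExtremes_hasApproxRatio {n : ℕ} (hn : 3 ≤ n) :
    (twoExtremes n).HasApproxRatio ((n : ℝ) - 2) := by
  have hn' : (3 : ℝ) ≤ n := by exact_mod_cast hn
  refine ⟨by linarith, fun x => ?_⟩
  rw [← div_le_iff₀' (by linarith)]
  refine le_ciInf fun y => ?_
  rw [div_le_iff₀' (by linarith)]
  exact twoExtremes_socialCost_le (by omega) x y

end FacilityLocation

theorem mainTheorem3 (n : ℕ) (hn : 5 ≤ n) :
    (∀ F : FacilityLocation.Mechanism n 2, F.Strategyproof →
      ∀ ρ : ℝ, F.HasApproxRatio ρ → (n : ℝ) - 2 ≤ ρ) ∧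
    ((FacilityLocation.twoExtremes n).Strategyproof ∧
      (FacilityLocation.twoExtremes n).HasApproxRatio ((n : ℝ) - 2)) ∧
    IsLeast {ρ : ℝ | ∃ F : FacilityLocation.Mechanism n 2, F.Strategyproof ∧ F.HasApproxRatio ρ}
      ((n : ℝ) - 2) := by
  have lower : ∀ F : FacilityLocation.Mechanism n 2, F.Strategyproof →
      ∀ ρ : ℝ, F.HasApproxRatio ρ → (n : ℝ) - 2 ≤ ρ := fun F hF ρ hρ => hρ.sub_two_le hn hF
  have sp := FacilityLocation.twoExtremes_strategyproof n
  have ratio := FacilityLocation.twoExtremes_hasApproxRatio (n := n) (by omega)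
  refine ⟨lower, ⟨sp, ratio⟩, ⟨_, sp, ratio⟩, ?_⟩
  rintro ρ ⟨F, hF, hρ⟩
  exact lower F hF ρ hρ
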